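/- Let $X$ be a sequentially complete Hausdorff locally convex space over $\mathbb{T}\in\{\mathbb{R},\mathbb{C}\}$ whose topology is generated by semi-norms $\|\cdot\|_\alpha$, $\alpha\in\Omega$, and let $\mathcal{L}(X)$ be the space of continuous linear operators on $X$ with the topology of pointwise convergence. A set $G\subset\mathcal{L}(X)$ is called equicontinuous if for each $\alpha\in\Omega$ there are finitely many $\alpha_i\in\Omega$ and $b_i>0$ such that $\sup_{g\in G}\|gx\|_\alpha\le\sum_i b_i\|x\|_{\alpha_i}$ for all $x\in X$. Let $\mathcal{E}_X$ be the set of all functions $F:[0,\infty)\to\mathcal{L}(X)$ such that $F(0)=I$ and, for each $s\ge 0$, the set $$\{F(d/n)^m : n,m\in\mathbb{N},\ n,m\ge 1,\ d\ge 0,\ md/n\le s\}$$ is equicontinuous. An $lC_0$-semigroup is a continuous function $T:[0,\infty)\to\mathcal{L}(X)$ with $T(0)=I$, $T(l+m)=T(l)T(m)$ for all $l,m\ge 0$, and $T\in\mathcal{E}_X$. Its generator is the linear operator $Z$ given by $Zx=\lim_{h\to 0+}h^{-1}(T(h)x-x)$, with domain $D(Z)$ the set of all $x\in X$ for which this limit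 exists; one writes $T(t)=\exp(tZ)$. A set $\mathcal{D}\subset D(Z)$ is a core of $Z$ if the closure of $\{(x,Zx):x\in\mathcal{D}\}$ in $X\times X$ is the graph of $Z$. **Theorem.** Let $A$, $B$ and $Z$ be generators of $lC_0$-semigroups in $X$, and let $\mathcal{D}$ be a core of $Z$. Suppose that $\mathcal{D}\subset D(A)\cap D(B)$, that $Zf=Af+Bf$ for all $f\in\mathcal{D}$, and that the function $s\mapsto\exp(sA)\exp(sB)$, $s\in[0,\infty)$, belongs to $\mathcal{E}_X$. Then for every $f\in X$ and every $t_0>0$, $$\left(\exp\left(\tfrac{t}{n}A\right)\exp\left(\tfrac{t}{n}B\right)\right)^n f\longrightarrow\exp(tZ)f\qquad(n\to\infty)$$ uniformly with respect to $t\in[0,t_0]$. -/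

import Mathlib

open Filter Topology
open scoped NNReal

namespace LCSemigroup

/-- Every Cauchy sequence converges. -/
def SeqComplete (X : Type*) [UniformSpace X] : Prop :=
  ∀ u : ℕ → X, CauchySeq u → ∃ x : X, Tendsto u atTop (𝓝 x)

section

variable {𝕜 X Ω : Type*} [RCLike 𝕜] [AddCommGroup X] [Module 𝕜 X]

/-- A set of operators is equicontinuous with respect to the family of semi-norms `p`: each
semi-norm of `g x`, for all `g` in the set at once, is bounded by a finite combination of
semi-norms of `x` with positive coefficients. -/
def EquicontinuousSet [TopologicalSpace X] (p : SeminormFamily 𝕜 X Ω)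
    (G : Set (X →L[𝕜] X)) : Prop :=
  ∀ α : Ω, ∃ (s : Finset Ω) (b : Ω → ℝ), (∀ i ∈ s, 0 < b i) ∧
    ∀ g ∈ G, ∀ x : X, p α (g x) ≤ ∑ i ∈ s, b i * p i x

/-- The set of all powers `F(d/n)^m` with `m d / n ≤ s`, where `n, m ≥ 1` are natural numbers
and `d ≥ 0` is real. -/
def powerSet [TopologicalSpace X] (F : ℝ≥0 → X →L[𝕜] X) (s : ℝ≥0) : Set (X →L[𝕜] X) :=
  {g | ∃ (n m : ℕ) (d : ℝ≥0), 0 < n ∧ 0 < m ∧ (m : ℝ≥0) * d / (n : ℝ≥0) ≤ s ∧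
    g = F (d / (n : ℝ≥0)) ^ m}

/-- The class `𝓔` of operator functions `F` on `[0, ∞)` with `F(0) = I` for which the set
`powerSet F s` is equicontinuous for each `s ≥ 0`. -/
structure MemE [TopologicalSpace X] (p : SeminormFamily 𝕜 X Ω) (F : ℝ≥0 → X →L[𝕜] X) :
    Prop where
  map_zero : F 0 = ContinuousLinearMap.id 𝕜 X
  equicontinuous : ∀ s : ℝ≥0, EquicontinuousSet p (powerSet F s)

/-- `lC₀`-semigroups. Continuity refers to the strong operator topology (the topology of
pointwise convergence). -/
structure IsLC0Semigroup [TopologicalSpace X] (p : SeminormFamily 𝕜 X Ω)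
    (T : ℝ≥0 → X →L[𝕜] X) : Prop where
  map_zero : T 0 = ContinuousLinearMap.id 𝕜 X
  map_add : ∀ l m : ℝ≥0, T (l + m) = (T l).comp (T m)
  continuous : ∀ x : X, Continuous fun s : ℝ≥0 => T s x
  memE : MemE p T

/-- The (partially defined) operator `Z` is the strong derivative at `0` of `F`: its domain is the
set of all `x` for which `h⁻¹ (F(h) x - F(0) x)` converges as `h → 0`, `h > 0`, and `Z x` is the
limit. -/
def IsDerivAtZero [TopologicalSpace X] (F : ℝ≥0 → X →L[𝕜] X) (Z : X →ₗ.[𝕜] X) : Prop :=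
  ∀ x y : X, (x, y) ∈ Z.graph ↔
    Tendsto (fun h : ℝ≥0 => (((h : ℝ) : 𝕜)⁻¹) • (F h x - F 0 x)) (𝓝[>] 0) (𝓝 y)

/-- `Z` is the generator of the `lC₀`-semigroup `T`; in symbols, `T t = exp (t Z)`. -/
structure IsGeneratorOf [TopologicalSpace X] (p : SeminormFamily 𝕜 X Ω) (Z : X →ₗ.[𝕜] X)
    (T : ℝ≥0 → X →L[𝕜] X) : Prop where
  isLC0Semigroup : IsLC0Semigroup p T
  isDerivAtZero : IsDerivAtZero T Z

/-- The set `D` (not necessarily a linear subspace) is a core of `Z`: it lies in the domain of `Z`,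
and the closure of `{(x, Z x) | x ∈ D}` in `X × X` is the graph of `Z`. -/
structure IsCore [TopologicalSpace X] (Z : X →ₗ.[𝕜] X) (D : Set X) : Prop where
  subset_domain : D ⊆ Z.domain
  closure_eq : closure {q : X × X | q.1 ∈ D ∧ q ∈ Z.graph} = (Z.graph : Set (X × X))

end

end LCSemigroup

/-!
The product formula is the case `F s = expA s ∘ expB s` of a Chernoff theorem
(`IsGeneratorOf.chernoff`): if the powers of `F` are equicontinuous and the derivative of `F` at `0`
extends the restriction of `Z` to a core, then `F (t / n) ^ n` converges strongly to `exp (t Z)`,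
uniformly on bounded intervals. Semigroups here need not have exponential growth bounds, so that
resolvents are not available; the proof is a finite-time "stability and consistency" argument.

*Stability* is the equicontinuity of the powers (`MemE.exists_bound`). It reduces the claim to `f` in
a dense set, and the domain of `Z` is dense (`IsGeneratorOf.exists_mem_graph_sub_le`): the limit of
the Riemann sums of an orbit over `[0, δ]` lies in the domain, and after division by `δ` it is close
to the starting point. This is where sequential completeness is used.

*Consistency* cannot be checked along the orbit `T s f` itself, as the orbit of a point of the domain
of `Z` need not stay where the derivative of `F` is known. Instead one takes points of the core close,
in the graph norm, to `T (j δ) f` for `j = 0, 1, …`, and lets `v` be the piecewise linear path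
through them (`interp`). The slopes of `v` are close to `T s (Z f)`
(`interp_increment_le`), and since only finitely many points of the core are involved,
`(F h (v s) - v s) / h` is close to `T s (Z f)` uniformly in `s` for small `h`. Hence
`F h (v s) - v (s + h)` is small compared with `h`, and by stability (`pow_apply_sub_le`) the errors of
the `n` steps add up to a small bound for `F (t / n) ^ n (v 0) - v t`
(`IsGeneratorOf.chernoff_of_mem_graph`).
-/

namespace LCSemigroup

/-! ### Continuous semi-norms, bounds and first-order expansions -/

section Seminorms

variable {𝕜 X Ω : Type*} [RCLike 𝕜] [AddCommGroup X] [Module 𝕜 X]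

theorem seminorm_ofReal_smul (P : Seminorm 𝕜 X) {r : ℝ} (hr : 0 ≤ r) (x : X) :
    P ((r : 𝕜) • x) = r * P x := by
  rw [map_smul_eq_mul, RCLike.norm_ofReal, abs_of_nonneg hr]

theorem seminorm_sum_le (P : Seminorm 𝕜 X) {ι : Type*} (s : Finset ι) (u : ι → X) :
    P (∑ i ∈ s, u i) ≤ ∑ i ∈ s, P (u i) :=
  Finset.le_sum_of_subadditive P (map_zero P).le (map_add_le_add P) s u

theorem seminorm_convex_le (P : Seminorm 𝕜 X) {θ c : ℝ} (h0 : 0 ≤ θ) (h1 : θ ≤ 1) {x y : X}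
    (hx : P x ≤ c) (hy : P y ≤ c) : P (((1 - θ : ℝ) : 𝕜) • x + (θ : 𝕜) • y) ≤ c := by
  refine (map_add_le_add P _ _).trans ?_
  rw [seminorm_ofReal_smul P (sub_nonneg.2 h1), seminorm_ofReal_smul P h0]
  have := mul_le_mul_of_nonneg_left hx (sub_nonneg.2 h1)
  have := mul_le_mul_of_nonneg_left hy h0
  linarith

theorem exists_seminorm_of_mem_uniformity [UniformSpace X] [IsUniformAddGroup X]
    {p : SeminormFamily 𝕜 X Ω} (hp : WithSeminorms p) {U : Set (X × X)} (hU : U ∈ uniformity X) :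
    ∃ (P : Seminorm 𝕜 X) (ε : ℝ), Continuous P ∧ 0 < ε ∧
      ∀ x y : X, P (y - x) < ε → (x, y) ∈ U := by
  rw [uniformity_eq_comap_nhds_zero] at hU
  obtain ⟨V, hV, hVU⟩ := hU
  obtain ⟨⟨s, ε⟩, hε, hs⟩ := hp.hasBasis_zero_ball.mem_iff.1 hV
  refine ⟨s.sup p, ε, Seminorm.continuous_finsetSup fun i _ => hp.continuous_seminorm i, hε,
    fun x y h => hVU (hs ?_)⟩
  simpa [Seminorm.mem_ball] using h

/-- The estimates defining equicontinuity of the powers of `F`, which concern the generating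
semi-norms, extend to all continuous semi-norms; the power `0` is included as well. -/
theorem MemE.exists_bound [TopologicalSpace X] {p : SeminormFamily 𝕜 X Ω} (hp : WithSeminorms p)
    {F : ℝ≥0 → X →L[𝕜] X} (hF : MemE p F) (s : ℝ≥0) {P : Seminorm 𝕜 X} (hP : Continuous P) :
    ∃ Q : Seminorm 𝕜 X, Continuous Q ∧ ∀ (m : ℕ) (h : ℝ≥0), m * h ≤ s →
      ∀ x, P ((F h ^ m) x) ≤ Q x := by
  have := hp.topologicalAddGroup
  have := hp.continuousSMul
  obtain ⟨t, C, -, hC⟩ := Seminorm.bound_of_continuous hp P hP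
  choose u b hb hub using fun α => hF.equicontinuous s α
  refine ⟨P + C • ∑ α ∈ t, ∑ i ∈ u α, (b α i).toNNReal • p i, ?_, ?_⟩
  · have : Continuous (fun x =>
        P x + (C : ℝ) * ∑ α ∈ t, ∑ i ∈ u α, ((b α i).toNNReal : ℝ) * p i x) := by
      have := hp.continuous_seminorm
      fun_prop
    convert this using 2 with x
    simp [NNReal.smul_def, sum_apply]
  · intro m h hm x
    have hval : (P + C • ∑ α ∈ t, ∑ i ∈ u α, (b α i).toNNReal • p i) x
        = P x + (C : ℝ) * ∑ α ∈ t, ∑ i ∈ u α, ((b α i).toNNReal : ℝ) * p i x := by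
      simp [NNReal.smul_def, sum_apply]
    rw [hval]
    have hnn : 0 ≤ (C : ℝ) * ∑ α ∈ t, ∑ i ∈ u α, ((b α i).toNNReal : ℝ) * p i x := by positivity
    rcases Nat.eq_zero_or_pos m with rfl | hm0
    · simpa using hnn
    · have h1 : P ((F h ^ m) x) ≤ C * (t.sup p) ((F h ^ m) x) := hC _
      have h2 : (t.sup p) ((F h ^ m) x) ≤ ∑ α ∈ t, p α ((F h ^ m) x) := by
        simpa [sum_apply] using Seminorm.finset_sup_le_sum p t ((F h ^ m) x)
      have h3 : ∑ α ∈ t, p α ((F h ^ m) x)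
          ≤ ∑ α ∈ t, ∑ i ∈ u α, ((b α i).toNNReal : ℝ) * p i x := by
        refine Finset.sum_le_sum fun α _ => ?_
        refine (hub α (F h ^ m) ⟨1, m, h, one_pos, hm0, by simpa using hm, by simp⟩ x).trans_eq ?_
        refine Finset.sum_congr rfl fun i hi => ?_
        rw [Real.coe_toNNReal _ (hb α i hi).le]
      have h4 := mul_le_mul_of_nonneg_left (h2.trans h3) C.coe_nonneg
      linarith [apply_nonneg P x]

/-- Membership in the graph of the derivative at `0`, as a first-order expansion in each
continuous semi-norm. The expansion holds at `h = 0` as well, trivially. -/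
theorem tendsto_quotient_iff [TopologicalSpace X] {p : SeminormFamily 𝕜 X Ω}
    (hp : WithSeminorms p) {F : ℝ≥0 → X →L[𝕜] X} (h0 : F 0 = ContinuousLinearMap.id 𝕜 X)
    (x y : X) :
    Tendsto (fun h : ℝ≥0 => (((h : ℝ) : 𝕜)⁻¹) • (F h x - F 0 x)) (𝓝[>] 0) (𝓝 y) ↔
      ∀ P : Seminorm 𝕜 X, Continuous P → ∀ ε : ℝ, 0 < ε → ∃ δ : ℝ≥0, 0 < δ ∧ ∀ h ≤ δ,
        P (F h x - x - ((h : ℝ) : 𝕜) • y) ≤ ε * h := by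
  have := hp.topologicalAddGroup
  have key : ∀ (P : Seminorm 𝕜 X) (h : ℝ≥0), 0 < h →
      P (F h x - x - ((h : ℝ) : 𝕜) • y)
        = h * P ((((h : ℝ) : 𝕜)⁻¹) • (F h x - F 0 x) - y) := by
    intro P h hh
    rw [← seminorm_ofReal_smul P h.coe_nonneg, smul_sub, smul_smul, mul_inv_cancel₀, one_smul, h0]
    · rfl
    · exact_mod_cast hh.ne'
  constructor
  · intro hT P hP ε hε
    have h1 : Tendsto (fun h : ℝ≥0 => P ((((h : ℝ) : 𝕜)⁻¹) • (F h x - F 0 x) - y))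
        (𝓝[>] 0) (𝓝 0) := by
      have := (hP.tendsto (y - y)).comp (hT.sub_const y)
      simpa [Function.comp_def] using this
    obtain ⟨δ, hδ, hs⟩ := mem_nhdsGT_iff_exists_Ioc_subset.1 (h1.eventually_lt_const hε)
    refine ⟨δ, hδ, fun h hh => ?_⟩
    rcases eq_zero_or_pos h with rfl | hpos
    · simp [h0]
    · rw [key P h hpos, mul_comm]
      exact mul_le_mul_of_nonneg_right (le_of_lt (hs ⟨hpos, hh⟩)) h.coe_nonneg
  · intro H
    rw [hp.tendsto_nhds]
    intro α ε hε
    obtain ⟨δ, hδ, hs⟩ := H (p α) (hp.continuous_seminorm α) (ε / 2) (half_pos hε)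
    refine mem_nhdsGT_iff_exists_Ioc_subset.2 ⟨δ, hδ, fun h hh => ?_⟩
    have h1 := hs h hh.2
    rw [key _ h hh.1, mul_comm] at h1
    have hpos : (0 : ℝ) < h := hh.1
    have := le_of_mul_le_mul_right h1 hpos
    show _ < ε
    linarith

end Seminorms

/-! ### Riemann sums of orbits and density of the domain -/

section Semigroup

variable {𝕜 X Ω : Type*} [RCLike 𝕜] [AddCommGroup X] [Module 𝕜 X]

theorem IsLC0Semigroup.exists_bound [TopologicalSpace X] {p : SeminormFamily 𝕜 X Ω}
    (hp : WithSeminorms p) {T : ℝ≥0 → X →L[𝕜] X} (hT : IsLC0Semigroup p T) (s : ℝ≥0)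
    {P : Seminorm 𝕜 X} (hP : Continuous P) :
    ∃ Q : Seminorm 𝕜 X, Continuous Q ∧ ∀ r ≤ s, ∀ x, P (T r x) ≤ Q x := by
  obtain ⟨Q, hQ, h⟩ := hT.memE.exists_bound hp s hP
  exact ⟨Q, hQ, fun r hr x => by simpa using h 1 r (by simpa using hr) x⟩

theorem IsLC0Semigroup.exists_forall_le [TopologicalSpace X] [IsTopologicalAddGroup X]
    {p : SeminormFamily 𝕜 X Ω}
    {T : ℝ≥0 → X →L[𝕜] X} (hT : IsLC0Semigroup p T) {P : Seminorm 𝕜 X} (hP : Continuous P)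
    (x : X) {ε : ℝ} (hε : 0 < ε) :
    ∃ δ : ℝ≥0, 0 < δ ∧ ∀ h ≤ δ, P (T h x - x) ≤ ε := by
  have h1 : Tendsto (fun h : ℝ≥0 => P (T h x - x)) (𝓝[>] 0) (𝓝 0) := by
    have := (hP.comp ((hT.continuous x).sub (continuous_const (y := x)))).tendsto 0
    refine Tendsto.mono_left ?_ nhdsWithin_le_nhds
    simpa [Function.comp_def, hT.map_zero] using this
  obtain ⟨δ, hδ, hs⟩ := mem_nhdsGT_iff_exists_Ioc_subset.1 (h1.eventually_lt_const hε)
  refine ⟨δ, hδ, fun h hh => ?_⟩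
  rcases eq_zero_or_pos h with rfl | hpos
  · simpa [hT.map_zero] using hε.le
  · exact le_of_lt (hs ⟨hpos, hh⟩)

theorem IsLC0Semigroup.add_apply [TopologicalSpace X] {p : SeminormFamily 𝕜 X Ω}
    {T : ℝ≥0 → X →L[𝕜] X} (hT : IsLC0Semigroup p T) (a b : ℝ≥0) (x : X) :
    T (a + b) x = T a (T b x) := by
  rw [hT.map_add]; rfl

/-- The sum of the values of the orbit of `x` at the first `n` multiples of `τ`, starting with
`0`. Multiplied by `τ` it is a Riemann sum of the orbit over `[0, n τ]`. -/
def orbitSum [TopologicalSpace X] (T : ℝ≥0 → X →L[𝕜] X) (x : X) (τ : ℝ≥0) (n : ℕ) : X :=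
  ∑ k ∈ Finset.range n, T (k * τ) x

theorem orbitSum_sub_le [TopologicalSpace X] (T : ℝ≥0 → X →L[𝕜] X) (x : X) (τ : ℝ≥0) (n : ℕ)
    (P : Seminorm 𝕜 X) {ε : ℝ} (h : ∀ r ≤ n * τ, P (T r x - x) ≤ ε) :
    P (orbitSum T x τ n - (n : 𝕜) • x) ≤ n * ε := by
  have h1 : orbitSum T x τ n - (n : 𝕜) • x = ∑ k ∈ Finset.range n, (T (k * τ) x - x) := by
    simp [orbitSum, Finset.sum_sub_distrib, Nat.cast_smul_eq_nsmul]
  rw [h1]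
  refine (seminorm_sum_le P _ _).trans ?_
  refine (Finset.sum_le_card_nsmul _ _ ε fun k hk => h _ ?_).trans_eq (by simp)
  have := (Finset.mem_range.1 hk).le
  gcongr

theorem IsLC0Semigroup.orbitSum_add [TopologicalSpace X] {p : SeminormFamily 𝕜 X Ω}
    {T : ℝ≥0 → X →L[𝕜] X} (hT : IsLC0Semigroup p T) (x : X) (τ : ℝ≥0) (l n : ℕ) :
    orbitSum T x τ (l + n) = orbitSum T x τ l + T (l * τ) (orbitSum T x τ n) := by
  simp only [orbitSum, Finset.sum_range_add, map_sum, ← hT.add_apply]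
  congr 1
  refine Finset.sum_congr rfl fun k _ => ?_
  congr 2
  push_cast; ring

theorem IsLC0Semigroup.orbitSum_refine_le [TopologicalSpace X] {p : SeminormFamily 𝕜 X Ω}
    {T : ℝ≥0 → X →L[𝕜] X} (hT : IsLC0Semigroup p T) {P Q : Seminorm 𝕜 X} {s : ℝ≥0}
    (hPQ : ∀ r ≤ s, ∀ x, P (T r x) ≤ Q x) (x : X) (τ : ℝ≥0) (m : ℕ) {ε : ℝ}
    (h : ∀ r ≤ m * τ, Q (T r x - x) ≤ ε) (n : ℕ) (hn : n * (m * τ) ≤ s) :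
    P ((m : 𝕜) • orbitSum T x (m * τ) n - orbitSum T x τ (n * m)) ≤ n * (m * ε) := by
  induction n with
  | zero => simp [orbitSum]
  | succ n ih =>
    have hle : (n : ℝ≥0) * (m * τ) ≤ s := le_trans (by gcongr; simp) hn
    have h1 : (m : 𝕜) • orbitSum T x (m * τ) (n + 1) - orbitSum T x τ ((n + 1) * m)
        = ((m : 𝕜) • orbitSum T x (m * τ) n - orbitSum T x τ (n * m))
          - T (n * (m * τ)) (orbitSum T x τ m - (m : 𝕜) • x) := by
      rw [add_mul, one_mul, hT.orbitSum_add x τ (n * m) m, hT.orbitSum_add x (m * τ) n 1]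
      have h2 : ((n * m : ℕ) : ℝ≥0) * τ = n * (m * τ) := by push_cast; ring
      have h3 : orbitSum T x (m * τ) 1 = x := by simp [orbitSum, hT.map_zero]
      rw [h2, h3, map_sub, map_smul]
      module
    rw [h1]
    refine (map_sub_le_add P _ _).trans ?_
    have h4 := (hPQ _ hle _).trans (orbitSum_sub_le T x τ m Q h)
    have := ih hle
    push_cast
    linarith

/-- The Riemann sum of the orbit of `x` over `[0, δ]` with `n` equal steps (`0` for `n = 0`). -/
noncomputable def riemannSum [TopologicalSpace X] (T : ℝ≥0 → X →L[𝕜] X) (x : X) (δ : ℝ≥0)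
    (n : ℕ) : X :=
  ((((δ / n : ℝ≥0) : ℝ)) : 𝕜) • orbitSum T x (δ / n) n

theorem IsLC0Semigroup.riemannSum_refine_le [TopologicalSpace X] {p : SeminormFamily 𝕜 X Ω}
    {T : ℝ≥0 → X →L[𝕜] X} (hT : IsLC0Semigroup p T) {P Q : Seminorm 𝕜 X} {δ : ℝ≥0}
    (hPQ : ∀ r ≤ δ, ∀ x, P (T r x) ≤ Q x) (x : X) {ε : ℝ} {n m : ℕ} (hn : n ≠ 0) (hm : m ≠ 0)
    (h : ∀ r ≤ δ / n, Q (T r x - x) ≤ ε) :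
    P (riemannSum T x δ n - riemannSum T x δ (n * m)) ≤ δ * ε := by
  have hn' : (n : ℝ≥0) ≠ 0 := by exact_mod_cast hn
  have hm' : (m : ℝ≥0) ≠ 0 := by exact_mod_cast hm
  have h1 : δ / n = m * (δ / (n * m : ℕ)) := by push_cast; field_simp
  have h2 : riemannSum T x δ n - riemannSum T x δ (n * m)
      = ((((δ / (n * m : ℕ) : ℝ≥0) : ℝ)) : 𝕜) • ((m : 𝕜) • orbitSum T x (m * (δ / (n * m : ℕ))) n
          - orbitSum T x (δ / (n * m : ℕ)) (n * m)) := by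
    rw [riemannSum, riemannSum, smul_sub, smul_smul, ← h1]
    congr 2
    rw [h1]; push_cast; ring
  rw [h2, seminorm_ofReal_smul P (NNReal.coe_nonneg _)]
  have h3 := hT.orbitSum_refine_le hPQ x (δ / (n * m : ℕ)) m (ε := ε) (by rwa [← h1]) n
    (by rw [← h1]; field_simp; rfl)
  refine (mul_le_mul_of_nonneg_left h3 (NNReal.coe_nonneg _)).trans_eq ?_
  have : (n : ℝ) ≠ 0 := by exact_mod_cast hn
  have : (m : ℝ) ≠ 0 := by exact_mod_cast hm
  push_cast; field_simp

theorem exists_nat_div_le (δ : ℝ≥0) {ρ : ℝ≥0} (hρ : 0 < ρ) :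
    ∃ N : ℕ, ∀ n ≥ N, 0 < n → δ / n ≤ ρ := by
  obtain ⟨N, hN⟩ := exists_nat_ge (δ / ρ)
  refine ⟨N, fun n hn h0 => ?_⟩
  have h0' : (0 : ℝ≥0) < n := by exact_mod_cast h0
  rw [div_le_iff₀ h0', mul_comm]
  rw [div_le_iff₀ hρ] at hN
  refine hN.trans ?_
  gcongr

theorem IsLC0Semigroup.cauchySeq_riemannSum [UniformSpace X] [IsUniformAddGroup X]
    {p : SeminormFamily 𝕜 X Ω} (hp : WithSeminorms p)
    {T : ℝ≥0 → X →L[𝕜] X} (hT : IsLC0Semigroup p T) (x : X) (δ : ℝ≥0) :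
    CauchySeq fun n : ℕ => riemannSum T x δ (n + 1) := by
  rw [cauchySeq_iff]
  intro U hU
  obtain ⟨P, ε, hP, hε, hPU⟩ := exists_seminorm_of_mem_uniformity hp hU
  obtain ⟨Q, hQ, hPQ⟩ := hT.exists_bound hp δ hP
  obtain ⟨ρ, hρ, hρx⟩ := hT.exists_forall_le hQ x (show 0 < ε / (2 * (δ + 1)) by positivity)
  obtain ⟨N, hN⟩ := exists_nat_div_le δ hρ
  have key : ∀ n ≥ N, ∀ m : ℕ, P (riemannSum T x δ (n + 1) -
      riemannSum T x δ ((n + 1) * (m + 1))) < ε / 2 := by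
    intro n hn m
    refine (hT.riemannSum_refine_le hPQ x n.succ_ne_zero m.succ_ne_zero fun r hr =>
      hρx r (hr.trans (hN _ (hn.trans n.le_succ) n.succ_pos))).trans_lt ?_
    rw [← mul_div_assoc, div_lt_div_iff₀ (by positivity) two_pos]
    nlinarith [δ.coe_nonneg]
  refine ⟨N, fun k hk l hl => hPU _ _ ?_⟩
  have h1 := key k hk l
  have h2 := key l hl k
  rw [mul_comm] at h1
  have h3 : riemannSum T x δ (l + 1) - riemannSum T x δ (k + 1)
      = (riemannSum T x δ (l + 1) - riemannSum T x δ ((l + 1) * (k + 1)))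
        - (riemannSum T x δ (k + 1) - riemannSum T x δ ((l + 1) * (k + 1))) := by abel
  rw [h3]
  refine (map_sub_le_add P _ _).trans_lt ?_
  linarith

/-- The difference quotients of a Riemann sum telescope: for a step `h = l δ / n` commensurable
with the partition, `T h` shifts the partition points. -/
theorem IsLC0Semigroup.riemannSum_shift [TopologicalSpace X] {p : SeminormFamily 𝕜 X Ω}
    {T : ℝ≥0 → X →L[𝕜] X} (hT : IsLC0Semigroup p T) (x : X) (δ : ℝ≥0) {n : ℕ} (hn : n ≠ 0)
    (l : ℕ) :
    T (l * (δ / n)) (riemannSum T x δ n) - riemannSum T x δ n =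
      T δ ((((δ / n : ℝ≥0) : ℝ) : 𝕜) • orbitSum T x (δ / n) l)
        - (((δ / n : ℝ≥0) : ℝ) : 𝕜) • orbitSum T x (δ / n) l := by
  have h1 := hT.orbitSum_add x (δ / n) l n
  rw [add_comm l n, hT.orbitSum_add x (δ / n) n l] at h1
  have h2 : (n : ℝ≥0) * (δ / n) = δ := mul_div_cancel₀ _ (by exact_mod_cast hn)
  rw [h2] at h1
  rw [riemannSum, map_smul, map_smul, ← smul_sub, ← smul_sub]
  congr 1
  rw [sub_eq_sub_iff_add_eq_add, add_comm, ← h1, add_comm]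

/-- The limit of the Riemann sums of the orbit of `x` over `[0, δ]` lies in the domain of the
generator, which maps it to `T δ x - x`. -/
theorem IsLC0Semigroup.tendsto_quotient_of_riemannSum [TopologicalSpace X]
    {p : SeminormFamily 𝕜 X Ω} (hp : WithSeminorms p)
    {T : ℝ≥0 → X →L[𝕜] X} (hT : IsLC0Semigroup p T) {x y : X} {δ : ℝ≥0} (hδ : 0 < δ)
    (hy : Tendsto (fun n : ℕ => riemannSum T x δ (n + 1)) atTop (𝓝 y)) :
    Tendsto (fun h : ℝ≥0 => (((h : ℝ) : 𝕜)⁻¹) • (T h y - T 0 y)) (𝓝[>] 0)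
      (𝓝 (T δ x - x)) := by
  have := hp.topologicalAddGroup
  have := hp.continuousSMul
  rw [tendsto_quotient_iff hp hT.map_zero]
  intro P hP ε hε
  obtain ⟨Q, hQ, hPQ⟩ := hT.exists_bound hp δ hP
  have hPQ0 : ∀ x, P x ≤ Q x := fun x => by simpa [hT.map_zero] using hPQ 0 zero_le x
  obtain ⟨ρ, hρ, hρx⟩ := hT.exists_forall_le hQ x (half_pos hε)
  refine ⟨ρ, hρ, fun h hh => ?_⟩
  -- Approximate `h` by the multiples `l δ / n` of the mesh of the partition.
  set l : ℕ → ℕ := fun n => ⌊h / (δ / ((n + 1 : ℕ) : ℝ≥0))⌋₊ with hl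
  set a : ℕ → ℝ≥0 := fun n => l n * (δ / ((n + 1 : ℕ) : ℝ≥0)) with ha
  have hmesh : ∀ n : ℕ, 0 < δ / ((n + 1 : ℕ) : ℝ≥0) := fun n => by positivity
  have ha_le : ∀ n, a n ≤ h := fun n => by
    rw [ha, ← le_div_iff₀ (hmesh n)]; exact Nat.floor_le zero_le
  have ha_ge : ∀ n, h ≤ a n + δ / ((n + 1 : ℕ) : ℝ≥0) := fun n => by
    have := (Nat.lt_floor_add_one (h / (δ / ((n + 1 : ℕ) : ℝ≥0)))).le
    rw [div_le_iff₀ (hmesh n)] at this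
    simpa [ha, hl, add_mul] using this
  have ha_tendsto : Tendsto a atTop (𝓝 h) := by
    have h0 : Tendsto (fun n : ℕ => δ / ((n + 1 : ℕ) : ℝ≥0)) atTop (𝓝 0) :=
      (tendsto_add_atTop_iff_nat (f := fun n : ℕ => δ / (n : ℝ≥0)) 1).2
        (NNReal.tendsto_coe.1 (by
          simpa using tendsto_const_div_atTop_nhds_zero_nat (δ : ℝ)))
    have h2 : Tendsto (fun n : ℕ => h - δ / ((n + 1 : ℕ) : ℝ≥0)) atTop (𝓝 h) := by
      simpa using h0.const_sub h
    exact tendsto_of_tendsto_of_tendsto_of_le_of_le h2 tendsto_const_nhds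
      (fun n => tsub_le_iff_right.2 (ha_ge n)) ha_le
  set u : ℕ → X := fun n => riemannSum T x δ (n + 1) with hu
  have hbound : ∀ n, P (T (a n) (u n) - u n - ((a n : ℝ) : 𝕜) • (T δ x - x)) ≤ ε * h := by
    intro n
    set w : X := (((δ / (n + 1 : ℕ) : ℝ≥0) : ℝ) : 𝕜) • orbitSum T x (δ / (n + 1 : ℕ)) (l n)
      - ((a n : ℝ) : 𝕜) • x with hw
    have h1 : T (a n) (u n) - u n - ((a n : ℝ) : 𝕜) • (T δ x - x) = T δ w - w := by
      rw [hT.riemannSum_shift x δ n.succ_ne_zero (l n), hw]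
      simp only [map_sub, map_smul]
      module
    have h2 : Q w ≤ a n * (ε / 2) := by
      have h3 : w = (((δ / (n + 1 : ℕ) : ℝ≥0) : ℝ) : 𝕜) •
          (orbitSum T x (δ / (n + 1 : ℕ)) (l n) - ((l n : ℕ) : 𝕜) • x) := by
        rw [hw, smul_sub, smul_smul, ha]
        congr 2
        push_cast; ring
      rw [h3, seminorm_ofReal_smul Q (NNReal.coe_nonneg _)]
      refine (mul_le_mul_of_nonneg_left (orbitSum_sub_le T x _ _ Q fun r hr =>
        hρx r (hr.trans ((ha_le n).trans hh))) (NNReal.coe_nonneg _)).trans_eq ?_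
      simp only [ha]; push_cast; ring
    rw [h1]
    refine (map_sub_le_add P _ _).trans ?_
    have h4 := hPQ δ le_rfl w
    have h5 := hPQ0 w
    have h6 : (a n : ℝ) ≤ h := ha_le n
    nlinarith
  have hTu : Tendsto (fun n => T (a n) (u n)) atTop (𝓝 (T h y)) := by
    rw [hp.tendsto_nhds]
    intro α η hη
    obtain ⟨R, hR, hαR⟩ := hT.exists_bound hp h (hp.continuous_seminorm α)
    have h1 : Tendsto (fun n => R (u n - y) + p α (T (a n) y - T h y)) atTop (𝓝 0) := by
      have e1 := (hR.tendsto _).comp (hy.sub_const y)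
      have e2 := ((hp.continuous_seminorm α).tendsto _).comp
        ((((hT.continuous y).tendsto h).comp ha_tendsto).sub_const (T h y))
      simpa [Function.comp_def] using e1.add e2
    filter_upwards [h1.eventually_lt_const hη] with n hn
    have h2 : T (a n) (u n) - T h y = T (a n) (u n - y) + (T (a n) y - T h y) := by
      rw [map_sub]; abel
    rw [h2]
    refine (map_add_le_add _ _ _).trans_lt (lt_of_le_of_lt ?_ hn)
    gcongr
    exact hαR _ (ha_le n) _
  have ha_cast : Tendsto (fun n => ((a n : ℝ) : 𝕜)) atTop (𝓝 ((h : ℝ) : 𝕜)) :=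
    ((RCLike.continuous_ofReal.comp NNReal.continuous_coe).tendsto h).comp ha_tendsto
  exact le_of_tendsto ((hP.tendsto _).comp ((hTu.sub hy).sub (ha_cast.smul_const _)))
    (Eventually.of_forall hbound)

/-- The domain of the generator is dense. -/
theorem IsGeneratorOf.exists_mem_graph_sub_le [UniformSpace X] [IsUniformAddGroup X]
    {p : SeminormFamily 𝕜 X Ω} (hp : WithSeminorms p) (hX : SeqComplete X) {Z : X →ₗ.[𝕜] X}
    {T : ℝ≥0 → X →L[𝕜] X} (hZ : IsGeneratorOf p Z T) {P : Seminorm 𝕜 X} (hP : Continuous P)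
    (x : X) {ε : ℝ} (hε : 0 < ε) : ∃ y z : X, (y, z) ∈ Z.graph ∧ P (y - x) ≤ ε := by
  have hT := hZ.isLC0Semigroup
  have := hp.continuousSMul
  obtain ⟨δ, hδ, hδx⟩ := hT.exists_forall_le hP x hε
  obtain ⟨y, hy⟩ := hX _ (hT.cauchySeq_riemannSum hp x δ)
  have hgr := (hZ.isDerivAtZero _ _).2 (hT.tendsto_quotient_of_riemannSum hp hδ hy)
  have hδ' : ((δ : ℝ) : 𝕜) ≠ 0 := by exact_mod_cast hδ.ne'
  refine ⟨((δ : ℝ) : 𝕜)⁻¹ • y, ((δ : ℝ) : 𝕜)⁻¹ • (T δ x - x), Z.graph.smul_mem _ hgr, ?_⟩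
  have h1 : P (y - ((δ : ℝ) : 𝕜) • x) ≤ δ * ε := by
    refine le_of_tendsto ((hP.tendsto _).comp (hy.sub_const _)) (Eventually.of_forall fun n => ?_)
    have hn : (((n + 1 : ℕ) : ℝ≥0)) ≠ 0 := by positivity
    have hmul : ((n + 1 : ℕ) : ℝ≥0) * (δ / (n + 1 : ℕ)) = δ := mul_div_cancel₀ _ hn
    have h2 : riemannSum T x δ (n + 1) - ((δ : ℝ) : 𝕜) • x
        = (((δ / (n + 1 : ℕ) : ℝ≥0) : ℝ) : 𝕜) •
          (orbitSum T x (δ / (n + 1 : ℕ)) (n + 1) - ((n + 1 : ℕ) : 𝕜) • x) := by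
      rw [riemannSum, smul_sub, smul_smul]
      congr 2
      have := congrArg (fun r : ℝ≥0 => ((r : ℝ) : 𝕜)) hmul
      rw [← this]
      push_cast; ring
    simp only [Function.comp_apply]
    rw [h2, seminorm_ofReal_smul P (NNReal.coe_nonneg _)]
    refine (mul_le_mul_of_nonneg_left (orbitSum_sub_le T x _ _ P fun r hr =>
      hδx r (hr.trans hmul.le)) (NNReal.coe_nonneg _)).trans_eq ?_
    have := congrArg (fun r : ℝ≥0 => (r : ℝ)) hmul
    push_cast at this ⊢
    rw [← mul_assoc, mul_comm _ ((n : ℝ) + 1), this]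
  have h2 : y - ((δ : ℝ) : 𝕜) • x = ((δ : ℝ) : 𝕜) • (((δ : ℝ) : 𝕜)⁻¹ • y - x) := by
    rw [smul_sub, smul_inv_smul₀ hδ']
  rw [h2, seminorm_ofReal_smul P δ.coe_nonneg] at h1
  exact le_of_mul_le_mul_left h1 hδ

end Semigroup

/-! ### Piecewise linear interpolation -/

section Interpolation

variable {𝕜 X : Type*} [RCLike 𝕜] [AddCommGroup X] [Module 𝕜 X]

variable (𝕜) in
/-- The piecewise linear path through the points `d 0, d 1, …` at the times `0, δ, 2 δ, …`. -/
noncomputable def interp (d : ℕ → X) (δ s : ℝ≥0) : X :=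
  ((1 - ((s / δ : ℝ≥0) - ⌊s / δ⌋₊ : ℝ) : ℝ) : 𝕜) • d ⌊s / δ⌋₊
    + (((s / δ : ℝ≥0) - ⌊s / δ⌋₊ : ℝ) : 𝕜) • d (⌊s / δ⌋₊ + 1)

theorem exists_cell {δ : ℝ≥0} (hδ : 0 < δ) (s : ℝ≥0) :
    ∃ (j : ℕ) (θ : ℝ), 0 ≤ θ ∧ θ < 1 ∧ (s : ℝ) = (j + θ) * δ := by
  refine ⟨⌊s / δ⌋₊, (s / δ : ℝ≥0) - ⌊s / δ⌋₊, ?_, ?_, ?_⟩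
  · have : ((⌊s / δ⌋₊ : ℝ≥0) : ℝ) ≤ (s / δ : ℝ≥0) := Nat.floor_le (zero_le (a := s / δ))
    simpa using this
  · have : ((s / δ : ℝ≥0) : ℝ) < ((⌊s / δ⌋₊ + 1 : ℝ≥0) : ℝ) := Nat.lt_floor_add_one (s / δ)
    push_cast at this ⊢
    linarith
  · have : (δ : ℝ) ≠ 0 := by exact_mod_cast hδ.ne'
    push_cast
    field_simp
    ring

theorem interp_eq (d : ℕ → X) {δ : ℝ≥0} (hδ : 0 < δ) {s : ℝ≥0} {j : ℕ} {θ : ℝ} (h0 : 0 ≤ θ)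
    (h1 : θ < 1) (hs : (s : ℝ) = (j + θ) * δ) :
    interp 𝕜 d δ s = ((1 - θ : ℝ) : 𝕜) • d j + (θ : 𝕜) • d (j + 1) := by
  have hδ' : (δ : ℝ) ≠ 0 := by exact_mod_cast hδ.ne'
  have hq : ((s / δ : ℝ≥0) : ℝ) = j + θ := by push_cast; rw [hs]; field_simp
  have hj : ⌊s / δ⌋₊ = j := by
    rw [Nat.floor_eq_iff zero_le]
    constructor
    · rw [← NNReal.coe_le_coe, hq]; simpa using h0
    · rw [← NNReal.coe_lt_coe, hq]; simpa using h1
  have hθ : ((s / δ : ℝ≥0) : ℝ) - (⌊s / δ⌋₊ : ℝ) = θ := by rw [hj, hq]; ring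
  rw [interp, hθ, hj]

/-- If the chords over two adjacent cells have slopes close to `g`, the increments of the
interpolating path starting in the first cell are close to those of slope `g`. -/
theorem interp_increment_le (Q : Seminorm 𝕜 X) (d : ℕ → X) {δ : ℝ≥0} (hδ : 0 < δ) {s h : ℝ≥0}
    (hh : h ≤ δ) {j : ℕ} {θ : ℝ} (h0 : 0 ≤ θ) (h1 : θ < 1) (hs : (s : ℝ) = (j + θ) * δ) (g : X)
    {c : ℝ} (hc1 : Q (d (j + 1) - d j - ((δ : ℝ) : 𝕜) • g) ≤ c * δ)
    (hc2 : Q (d (j + 2) - d (j + 1) - ((δ : ℝ) : 𝕜) • g) ≤ c * δ) :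
    Q (interp 𝕜 d δ (s + h) - interp 𝕜 d δ s - ((h : ℝ) : 𝕜) • g) ≤ c * h := by
  have hδ' : (0 : ℝ) < δ := hδ
  obtain ⟨κ, hκ⟩ : ∃ κ : ℝ, (h : ℝ) = κ * δ := ⟨h / δ, by field_simp⟩
  have hκ0 : 0 ≤ κ := by
    have := h.coe_nonneg; rw [hκ] at this; exact nonneg_of_mul_nonneg_left this hδ'
  have hκ1 : κ ≤ 1 := by
    have : (h : ℝ) ≤ δ := hh
    rw [hκ] at this; nlinarith
  rw [interp_eq d hδ h0 h1 hs, hκ]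
  rcases lt_or_ge (θ + κ) 1 with hlt | hge
  · rw [interp_eq d hδ (add_nonneg h0 hκ0) hlt (j := j) (by push_cast; rw [hs, hκ]; ring)]
    have e : ((1 - (θ + κ) : ℝ) : 𝕜) • d j + ((θ + κ : ℝ) : 𝕜) • d (j + 1)
        - (((1 - θ : ℝ) : 𝕜) • d j + (θ : 𝕜) • d (j + 1)) - ((κ * δ : ℝ) : 𝕜) • g
        = (κ : 𝕜) • (d (j + 1) - d j - ((δ : ℝ) : 𝕜) • g) := by
      push_cast; module
    rw [e, seminorm_ofReal_smul Q hκ0]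
    nlinarith
  · rw [interp_eq d hδ (sub_nonneg.2 hge) (by linarith) (j := j + 1)
      (by push_cast; rw [hs, hκ]; ring)]
    have e : ((1 - (θ + κ - 1) : ℝ) : 𝕜) • d (j + 1) + ((θ + κ - 1 : ℝ) : 𝕜) • d (j + 1 + 1)
        - (((1 - θ : ℝ) : 𝕜) • d j + (θ : 𝕜) • d (j + 1)) - ((κ * δ : ℝ) : 𝕜) • g
        = ((1 - θ : ℝ) : 𝕜) • (d (j + 1) - d j - ((δ : ℝ) : 𝕜) • g)
          + ((θ + κ - 1 : ℝ) : 𝕜) • (d (j + 2) - d (j + 1) - ((δ : ℝ) : 𝕜) • g) := by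
      push_cast; module
    rw [e]
    refine (map_add_le_add Q _ _).trans ?_
    rw [seminorm_ofReal_smul Q (by linarith), seminorm_ofReal_smul Q (by linarith)]
    have e1 := mul_le_mul_of_nonneg_left hc1 (show 0 ≤ 1 - θ by linarith)
    have e2 := mul_le_mul_of_nonneg_left hc2 (show 0 ≤ θ + κ - 1 by linarith)
    linarith

end Interpolation

/-! ### The Chernoff product formula -/

section Chernoff

variable {𝕜 X Ω : Type*} [RCLike 𝕜] [AddCommGroup X] [Module 𝕜 X]

/-- Stability and consistency give convergence: if the powers of `G` are bounded and each step of
`w` is a step of `G` up to an error `c`, then `n` steps accumulate an error of at most `n c`. -/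
theorem pow_apply_sub_le [TopologicalSpace X] (P Q : Seminorm 𝕜 X) (G : X →L[𝕜] X) {c : ℝ} (n : ℕ)
    (hG : ∀ m ≤ n, ∀ x, P ((G ^ m) x) ≤ Q x) (w : ℕ → X)
    (hw : ∀ k < n, Q (G (w k) - w (k + 1)) ≤ c) :
    P ((G ^ n) (w 0) - w n) ≤ n * c := by
  induction n generalizing w with
  | zero => simp
  | succ n ih =>
    have h1 := ih (fun m hm => hG m (hm.trans n.le_succ)) (fun k => w (k + 1))
      (fun k hk => hw (k + 1) (by omega))
    have h2 := (hG n n.le_succ _).trans (hw 0 n.succ_pos)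
    have h3 : (G ^ (n + 1)) (w 0) - w (n + 1)
        = (G ^ n) (G (w 0) - w (0 + 1)) + ((G ^ n) (w (0 + 1)) - w (n + 1)) := by
      rw [pow_succ, map_sub]
      simp
    have h4 : ((n + 1 : ℕ) : ℝ) * c = n * c + c := by rw [Nat.cast_succ]; ring
    rw [h3, h4]
    refine (map_add_le_add P _ _).trans ?_
    linarith

theorem IsGeneratorOf.map_mem_graph [TopologicalSpace X] {p : SeminormFamily 𝕜 X Ω}
    {Z : X →ₗ.[𝕜] X} {T : ℝ≥0 → X →L[𝕜] X} (hZ : IsGeneratorOf p Z T) {x y : X}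
    (h : (x, y) ∈ Z.graph) (s : ℝ≥0) : (T s x, T s y) ∈ Z.graph := by
  rw [hZ.isDerivAtZero] at h ⊢
  have hT := hZ.isLC0Semigroup
  refine (((T s).continuous.tendsto y).comp h).congr fun r => ?_
  simp only [Function.comp_apply, map_smul, map_sub, ← hT.add_apply]
  rw [add_comm s r, add_comm s 0]

theorem IsCore.exists_mem_sub_le [TopologicalSpace X] [IsTopologicalAddGroup X] {Z : X →ₗ.[𝕜] X}
    {D : Set X} (hD : IsCore Z D) {Q : Seminorm 𝕜 X} (hQ : Continuous Q) {x y : X}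
    (h : (x, y) ∈ Z.graph) {ε : ℝ} (hε : 0 < ε) :
    ∃ d e : X, d ∈ D ∧ (d, e) ∈ Z.graph ∧ Q (d - x) ≤ ε ∧ Q (e - y) ≤ ε := by
  have h1 : (x, y) ∈ closure {q : X × X | q.1 ∈ D ∧ q ∈ Z.graph} := by rw [hD.closure_eq]; exact h
  have h2 : {q : X × X | Q (q.1 - x) < ε ∧ Q (q.2 - y) < ε} ∈ 𝓝 (x, y) := by
    refine IsOpen.mem_nhds ?_ (by simpa using hε)
    exact (isOpen_lt (hQ.comp (continuous_fst.sub continuous_const)) continuous_const).inter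
      (isOpen_lt (hQ.comp (continuous_snd.sub continuous_const)) continuous_const)
  obtain ⟨⟨d, e⟩, ⟨hd1, hd2⟩, hd, hde⟩ := mem_closure_iff_nhds.1 h1 _ h2
  exact ⟨d, e, hd, hde, hd1.le, hd2.le⟩

/-- The Chernoff product formula on the domain of the generator. -/
theorem IsGeneratorOf.chernoff_of_mem_graph [TopologicalSpace X] {p : SeminormFamily 𝕜 X Ω}
    (hp : WithSeminorms p) {F T : ℝ≥0 → X →L[𝕜] X} (hF : MemE p F) {Z : X →ₗ.[𝕜] X}
    (hZ : IsGeneratorOf p Z T) {D : Set X} (hD : IsCore Z D)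
    (hFD : ∀ d e : X, d ∈ D → (d, e) ∈ Z.graph → ∀ P : Seminorm 𝕜 X, Continuous P →
      ∀ ε : ℝ, 0 < ε → ∃ δ : ℝ≥0, 0 < δ ∧ ∀ h ≤ δ,
        P (F h d - d - ((h : ℝ) : 𝕜) • e) ≤ ε * h)
    {f y : X} (hfy : (f, y) ∈ Z.graph) {P : Seminorm 𝕜 X} (hP : Continuous P) (t₀ : ℝ≥0)
    {ε : ℝ} (hε : 0 < ε) :
    ∃ N : ℕ, ∀ n ≥ N, 0 < n → ∀ t ≤ t₀, P ((F (t / n) ^ n) f - T t f) ≤ ε := by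
  have := hp.topologicalAddGroup
  have := hp.continuousSMul
  have hT := hZ.isLC0Semigroup
  obtain ⟨Q, hQ, hPQ⟩ := hF.exists_bound hp t₀ hP
  have hPQ0 : ∀ x, P x ≤ Q x := fun x => by simpa using hPQ 0 0 (by simp) x
  obtain ⟨R, hR, hQR⟩ := hT.exists_bound hp (t₀ + 2) hQ
  -- The accumulated error will be `7 η t₀` from the steps and `2 η` at each of the end points.
  set η : ℝ := ε / (7 * (t₀ + 1)) with hη_def
  have hη : 0 < η := by positivity
  -- A time mesh fine enough for the orbits of `f` and `y` to be almost linear, respectively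
  -- almost constant, over one cell.
  obtain ⟨δ₁, hδ₁, hexp⟩ := (tendsto_quotient_iff hp hT.map_zero f y).1
    ((hZ.isDerivAtZero f y).1 hfy) R hR η hη
  obtain ⟨δ₂, hδ₂, hy⟩ := hT.exists_forall_le hR y hη
  obtain ⟨δ₃, hδ₃, hf⟩ := hT.exists_forall_le hR f hη
  obtain ⟨δ, hδ, hδ1, hδle₁, hδle₂, hδle₃⟩ : ∃ δ : ℝ≥0, 0 < δ ∧ δ ≤ 1 ∧ δ ≤ δ₁ ∧ δ ≤ δ₂ ∧ δ ≤ δ₃ :=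
    ⟨min 1 (min δ₁ (min δ₂ δ₃)), by simp [*], by simp, by simp, by simp, by simp⟩
  have hδ' : (0 : ℝ) < δ := hδ
  have hδ1' : (δ : ℝ) ≤ 1 := hδ1
  -- Nodes in the core, close to the orbit of `f` in the graph norm. The distance is small even
  -- relative to `δ`, so that the slopes of the chords are controlled.
  choose d e hdD hde hdu heg using fun j : ℕ =>
    hD.exists_mem_sub_le hQ (hZ.map_mem_graph hfy (j * δ)) (mul_pos hη hδ')
  have heg' : ∀ j, Q (e j - T (j * δ) y) ≤ η := fun j => (heg j).trans (by nlinarith)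
  have hdu' : ∀ j, Q (d j - T (j * δ) f) ≤ η := fun j => (hdu j).trans (by nlinarith)
  have hsucc : ∀ (j : ℕ) (x : X), T ((j + 1 : ℕ) * δ) x = T (j * δ) (T δ x) := fun j x => by
    rw [← hT.add_apply]; push_cast; rw [add_mul, one_mul]
  have hslope : ∀ j : ℕ, (j : ℝ≥0) * δ ≤ t₀ + 2 →
      Q (d (j + 1) - d j - ((δ : ℝ) : 𝕜) • T (j * δ) y) ≤ 3 * η * δ := by
    intro j hj
    have e1 : d (j + 1) - d j - ((δ : ℝ) : 𝕜) • T (j * δ) y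
        = (d (j + 1) - T ((j + 1 : ℕ) * δ) f) - (d j - T (j * δ) f)
          + T (j * δ) (T δ f - f - ((δ : ℝ) : 𝕜) • y) := by
      rw [hsucc, map_sub, map_sub, map_smul]; abel
    rw [e1]
    refine (map_add_le_add Q _ _).trans ?_
    have e2 := map_sub_le_add Q (d (j + 1) - T ((j + 1 : ℕ) * δ) f) (d j - T (j * δ) f)
    have e3 := (hQR _ hj _).trans (hexp δ hδle₁)
    have e4 := hdu j
    have e5 := hdu (j + 1)
    linarith
  have hyj : ∀ j : ℕ, (j : ℝ≥0) * δ ≤ t₀ + 2 →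
      Q (T ((j + 1 : ℕ) * δ) y - T (j * δ) y) ≤ η := by
    intro j hj
    rw [hsucc, ← map_sub]
    exact (hQR _ hj _).trans (hy δ hδle₂)
  -- Only finitely many nodes matter on `[0, t₀]`, so one step size serves all of them.
  set M : ℕ := ⌈t₀ / δ⌉₊ + 1 with hM
  choose ρ hρ hρd using fun j => hFD (d j) (e j) (hdD j) (hde j) Q hQ η hη
  obtain ⟨h₀, hh₀, hh₀δ, hh₀ρ⟩ : ∃ h₀ : ℝ≥0, 0 < h₀ ∧ h₀ ≤ δ ∧ ∀ j ≤ M, h₀ ≤ ρ j := by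
    refine ⟨min δ ((Finset.range (M + 1)).inf' Finset.nonempty_range_add_one ρ), ?_, min_le_left _ _, ?_⟩
    · exact lt_min hδ ((Finset.lt_inf'_iff _).2 fun j _ => hρ j)
    · intro j hj
      exact (min_le_right _ _).trans (Finset.inf'_le _ (by simpa using Nat.lt_succ_of_le hj))
  set v : ℝ≥0 → X := interp 𝕜 d δ with hv
  have hcell_le : ∀ (s : ℝ≥0) (j : ℕ) (θ : ℝ), 0 ≤ θ → (s : ℝ) = (j + θ) * δ →
      (j : ℝ≥0) * δ ≤ s := by
    intro s j θ h0 hs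
    rw [← NNReal.coe_le_coe, hs]; push_cast
    nlinarith
  have hstep : ∀ s ≤ t₀, ∀ h ≤ h₀, Q (F h (v s) - v (s + h)) ≤ 7 * η * h := by
    intro s hs h hh
    obtain ⟨j, θ, h0, h1, hsj⟩ := exists_cell hδ s
    have hjs := (hcell_le s j θ h0 hsj).trans hs
    have hj2 : (j : ℝ≥0) * δ ≤ t₀ + 2 := hjs.trans (by simp)
    have hj2' : ((j + 1 : ℕ) : ℝ≥0) * δ ≤ t₀ + 2 := by
      push_cast; rw [add_mul, one_mul]
      exact add_le_add hjs (hδ1.trans one_le_two)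
    have hjM : j + 1 ≤ M := by
      have e1 : (j : ℝ≥0) ≤ t₀ / δ := by rwa [le_div_iff₀ hδ]
      have e2 : (j : ℝ≥0) ≤ (⌈t₀ / δ⌉₊ : ℕ) := e1.trans (Nat.le_ceil _)
      have e3 : j ≤ ⌈t₀ / δ⌉₊ := by exact_mod_cast e2
      omega
    set g : X := T (j * δ) y with hg
    have hhR : (0 : ℝ) ≤ h := h.coe_nonneg
    -- The increment of the path.
    have hinc : Q (v (s + h) - v s - ((h : ℝ) : 𝕜) • g) ≤ 4 * η * h := by
      refine interp_increment_le Q d hδ (hh.trans hh₀δ) h0 h1 hsj g ?_ ?_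
      · exact (hslope j hj2).trans (by gcongr; norm_num)
      · have e1 : d (j + 2) - d (j + 1) - ((δ : ℝ) : 𝕜) • g
            = (d (j + 1 + 1) - d (j + 1) - ((δ : ℝ) : 𝕜) • T ((j + 1 : ℕ) * δ) y)
              + ((δ : ℝ) : 𝕜) • (T ((j + 1 : ℕ) * δ) y - g) := by
          module
        rw [e1]
        refine (map_add_le_add Q _ _).trans ?_
        rw [seminorm_ofReal_smul Q δ.coe_nonneg]
        have e2 := hslope (j + 1) hj2'
        have e3 := mul_le_mul_of_nonneg_left (hyj j hj2) δ.coe_nonneg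
        linarith
    -- The increment produced by `F h`.
    have hnode : ∀ i ≤ M, ∀ c, Q (T (i * δ) y - g) ≤ c →
        Q (F h (d i) - d i - ((h : ℝ) : 𝕜) • g) ≤ (2 * η + c) * h := by
      intro i hi c hc
      have e1 : F h (d i) - d i - ((h : ℝ) : 𝕜) • g
          = (F h (d i) - d i - ((h : ℝ) : 𝕜) • e i)
            + ((h : ℝ) : 𝕜) • ((e i - T (i * δ) y) + (T (i * δ) y - g)) := by
        module
      rw [e1]
      refine (map_add_le_add Q _ _).trans ?_
      rw [seminorm_ofReal_smul Q hhR]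
      have e2 := hρd i h (hh.trans (hh₀ρ i hi))
      have e3 := mul_le_mul_of_nonneg_left ((map_add_le_add Q (e i - T (i * δ) y)
        (T (i * δ) y - g)).trans (add_le_add (heg' i) hc)) hhR
      linarith
    have hFv : Q (F h (v s) - v s - ((h : ℝ) : 𝕜) • g) ≤ 3 * η * h := by
      have e1 : F h (v s) - v s - ((h : ℝ) : 𝕜) • g
          = ((1 - θ : ℝ) : 𝕜) • (F h (d j) - d j - ((h : ℝ) : 𝕜) • g)
            + (θ : 𝕜) • (F h (d (j + 1)) - d (j + 1) - ((h : ℝ) : 𝕜) • g) := by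
        rw [hv, interp_eq d hδ h0 h1 hsj, map_add, map_smul, map_smul]
        push_cast; module
      rw [e1]
      refine seminorm_convex_le Q h0 h1.le ?_ ?_
      · refine (hnode j (by omega) 0 (by simp [hg])).trans ?_
        nlinarith
      · refine (hnode (j + 1) hjM η (hyj j hj2)).trans_eq ?_
        ring
    have e1 : F h (v s) - v (s + h) = (F h (v s) - v s - ((h : ℝ) : 𝕜) • g)
        - (v (s + h) - v s - ((h : ℝ) : 𝕜) • g) := by abel
    rw [e1]
    refine (map_sub_le_add Q _ _).trans ?_
    linarith
  have hvT : ∀ s ≤ t₀, Q (v s - T s f) ≤ 2 * η := by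
    intro s hs
    obtain ⟨j, θ, h0, h1, hsj⟩ := exists_cell hδ s
    have hjs := hcell_le s j θ h0 hsj
    have hjs' : s ≤ (j + 1 : ℕ) * δ := by
      rw [← NNReal.coe_le_coe, hsj]; push_cast
      nlinarith
    have e1 : v s - T s f = ((1 - θ : ℝ) : 𝕜) • (d j - T s f)
        + (θ : 𝕜) • (d (j + 1) - T s f) := by
      rw [hv, interp_eq d hδ h0 h1 hsj]
      push_cast; module
    rw [e1]
    refine seminorm_convex_le Q h0 h1.le ?_ ?_
    · obtain ⟨r, rfl⟩ := exists_add_of_le hjs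
      have hr : r ≤ δ := by
        push_cast at hjs'; rw [add_mul, one_mul] at hjs'
        exact le_of_add_le_add_left hjs'
      have e2 : d j - T (j * δ + r) f = (d j - T (j * δ) f) - T (j * δ) (T r f - f) := by
        rw [hT.add_apply, map_sub]; abel
      rw [e2]
      refine (map_sub_le_add Q _ _).trans ?_
      have e3 := (hQR (j * δ) ((hjs.trans hs).trans (by simp)) _).trans (hf r (hr.trans hδle₃))
      have e4 := hdu' j
      linarith
    · obtain ⟨r, hr⟩ := exists_add_of_le hjs'
      have hrδ : r ≤ δ := by
        push_cast at hr; rw [add_mul, one_mul] at hr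
        have : s + r ≤ s + δ := by rw [← hr]; gcongr
        exact le_of_add_le_add_left this
      have e2 : d (j + 1) - T s f = (d (j + 1) - T ((j + 1 : ℕ) * δ) f) + T s (T r f - f) := by
        rw [hr, hT.add_apply, map_sub]; abel
      rw [e2]
      refine (map_add_le_add Q _ _).trans ?_
      have e3 := (hQR s (hs.trans (by simp)) _).trans (hf r (hrδ.trans hδle₃))
      have e4 := hdu' (j + 1)
      linarith
  obtain ⟨N, hN⟩ := exists_nat_div_le t₀ hh₀
  refine ⟨N, fun n hn hn0 t ht => ?_⟩
  have hn0' : (n : ℝ≥0) ≠ 0 := by exact_mod_cast hn0.ne'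
  have hh : t / n ≤ h₀ := (by gcongr : t / n ≤ t₀ / n).trans (hN n hn hn0)
  have hnt : (n : ℝ≥0) * (t / n) = t := mul_div_cancel₀ _ hn0'
  have hk : ∀ k ≤ n, (k : ℝ≥0) * (t / n) ≤ t := fun k hk =>
    (by gcongr : (k : ℝ≥0) * (t / n) ≤ n * (t / n)).trans hnt.le
  have h1 := pow_apply_sub_le P Q (F (t / n)) n
    (fun m hm x => hPQ m (t / n) ((hk m hm).trans ht) x) (fun k => v (k * (t / n)))
    (c := 7 * η * (t / n : ℝ≥0)) (fun k hkn => by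
      have := hstep (k * (t / n)) ((hk k hkn.le).trans ht) (t / n) hh
      rwa [show ((k + 1 : ℕ) : ℝ≥0) * (t / n) = k * (t / n) + t / n by push_cast; ring])
  simp only [Nat.cast_zero, zero_mul, hnt] at h1
  have h2 : (n : ℝ) * (7 * η * (t / n : ℝ≥0)) ≤ 7 * η * t₀ := by
    have e1 : (n : ℝ) * (t / n : ℝ≥0) = t := by exact_mod_cast hnt
    have e2 : (t : ℝ) ≤ t₀ := ht
    calc (n : ℝ) * (7 * η * (t / n : ℝ≥0)) = 7 * η * (n * (t / n : ℝ≥0)) := by ring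
      _ ≤ 7 * η * t₀ := by rw [e1]; gcongr
  have h3 : P ((F (t / n) ^ n) (v 0 - f)) ≤ 2 * η := by
    refine (hPQ n (t / n) ((hk n le_rfl).trans ht) _).trans ?_
    simpa [hT.map_zero] using hvT 0 zero_le
  have h4 := (hPQ0 _).trans (hvT t ht)
  have h5 : (F (t / n) ^ n) f - T t f = ((F (t / n) ^ n) (v 0) - v t)
      - (F (t / n) ^ n) (v 0 - f) + (v t - T t f) := by
    rw [map_sub]; abel
  rw [h5]
  refine (map_add_le_add P _ _).trans ?_
  have h6 := map_sub_le_add P ((F (t / n) ^ n) (v 0) - v t) ((F (t / n) ^ n) (v 0 - f))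
  have h7 : 7 * η * (t₀ + 1) = ε := by rw [hη_def]; field_simp
  linarith

/-- The Chernoff product formula: a family `F` with equicontinuous powers whose derivative at `0`
extends the restriction of the generator to a core approximates the semigroup. -/
theorem IsGeneratorOf.chernoff [UniformSpace X] [IsUniformAddGroup X] {p : SeminormFamily 𝕜 X Ω}
    (hp : WithSeminorms p) (hX : SeqComplete X) {F T : ℝ≥0 → X →L[𝕜] X} (hF : MemE p F)
    {Z : X →ₗ.[𝕜] X} (hZ : IsGeneratorOf p Z T) {D : Set X} (hD : IsCore Z D)
    (hFD : ∀ d e : X, d ∈ D → (d, e) ∈ Z.graph → ∀ P : Seminorm 𝕜 X, Continuous P →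
      ∀ ε : ℝ, 0 < ε → ∃ δ : ℝ≥0, 0 < δ ∧ ∀ h ≤ δ,
        P (F h d - d - ((h : ℝ) : 𝕜) • e) ≤ ε * h) (f : X) (t₀ : ℝ≥0) :
    TendstoUniformlyOn (fun (n : ℕ) (t : ℝ≥0) => (F (t / n) ^ n) f) (fun t => T t f) atTop
      (Set.Icc 0 t₀) := by
  intro U hU
  obtain ⟨P, ε, hP, hε, hPU⟩ := exists_seminorm_of_mem_uniformity hp hU
  obtain ⟨Q, hQ, hPQ⟩ := hF.exists_bound hp t₀ hP
  obtain ⟨R, hR, hPR⟩ := hZ.isLC0Semigroup.exists_bound hp t₀ hP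
  have hε4 : 0 < ε / 4 := by positivity
  have hQR : Continuous (Q + R : Seminorm 𝕜 X) := hQ.add hR
  obtain ⟨x, y, hxy, hxf⟩ := hZ.exists_mem_graph_sub_le hp hX hQR f hε4
  have hxf' : Q (x - f) + R (x - f) ≤ ε / 4 := hxf
  obtain ⟨N, hN⟩ := hZ.chernoff_of_mem_graph hp hF hD hFD hxy hP t₀ hε4
  filter_upwards [eventually_ge_atTop N, eventually_gt_atTop 0] with n hn hn0 t ht
  refine hPU _ _ ?_
  have hnt : (n : ℝ≥0) * (t / n) = t := mul_div_cancel₀ _ (by exact_mod_cast hn0.ne')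
  have h1 := hN n hn hn0 t ht.2
  have h2 := hPQ n (t / n) (hnt.le.trans ht.2) (x - f)
  have h3 := hPR t ht.2 (x - f)
  have h4 : (F (t / n) ^ n) f - T t f = ((F (t / n) ^ n) x - T t x)
      - (F (t / n) ^ n) (x - f) + T t (x - f) := by
    rw [map_sub, map_sub]; abel
  rw [h4]
  refine (map_add_le_add P _ _).trans_lt ?_
  have h5 := map_sub_le_add P ((F (t / n) ^ n) x - T t x) ((F (t / n) ^ n) (x - f))
  linarith [apply_nonneg Q (x - f), apply_nonneg R (x - f)]

/-- The product of two semigroups has at `0` the derivative `A + B` on `D(A) ∩ D(B)`. -/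
theorem IsGeneratorOf.comp_expansion [TopologicalSpace X] {p : SeminormFamily 𝕜 X Ω}
    (hp : WithSeminorms p) {A B : X →ₗ.[𝕜] X} {S T : ℝ≥0 → X →L[𝕜] X} (hA : IsGeneratorOf p A S)
    (hB : IsGeneratorOf p B T) {x a b : X} (ha : (x, a) ∈ A.graph) (hb : (x, b) ∈ B.graph)
    {P : Seminorm 𝕜 X} (hP : Continuous P) {ε : ℝ} (hε : 0 < ε) :
    ∃ δ : ℝ≥0, 0 < δ ∧ ∀ h ≤ δ,
      P ((S h).comp (T h) x - x - ((h : ℝ) : 𝕜) • (a + b)) ≤ ε * h := by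
  have := hp.topologicalAddGroup
  have hε3 : 0 < ε / 3 := by positivity
  have hS := hA.isLC0Semigroup
  obtain ⟨Q, hQ, hPQ⟩ := hS.exists_bound hp 1 hP
  obtain ⟨δ₁, hδ₁, h1⟩ := (tendsto_quotient_iff hp hS.map_zero x a).1
    ((hA.isDerivAtZero x a).1 ha) P hP _ hε3
  obtain ⟨δ₂, hδ₂, h2⟩ := (tendsto_quotient_iff hp hB.isLC0Semigroup.map_zero x b).1
    ((hB.isDerivAtZero x b).1 hb) Q hQ _ hε3
  obtain ⟨δ₃, hδ₃, h3⟩ := hS.exists_forall_le hP b hε3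
  refine ⟨min 1 (min δ₁ (min δ₂ δ₃)), by simp [*], fun h hh => ?_⟩
  simp only [le_min_iff] at hh
  obtain ⟨hh1, hhδ₁, hhδ₂, hhδ₃⟩ := hh
  have e1 : (S h).comp (T h) x - x - ((h : ℝ) : 𝕜) • (a + b)
      = S h (T h x - x - ((h : ℝ) : 𝕜) • b) + ((h : ℝ) : 𝕜) • (S h b - b)
        + (S h x - x - ((h : ℝ) : 𝕜) • a) := by
    simp only [ContinuousLinearMap.comp_apply, map_sub, map_smul]
    module
  rw [e1]
  refine (map_add_le_add P _ _).trans ?_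
  have e2 := map_add_le_add P (S h (T h x - x - ((h : ℝ) : 𝕜) • b)) (((h : ℝ) : 𝕜) • (S h b - b))
  rw [seminorm_ofReal_smul P h.coe_nonneg] at e2
  have e3 := (hPQ h hh1 _).trans (h2 h hhδ₂)
  have e4 := mul_le_mul_of_nonneg_left (h3 h hhδ₃) h.coe_nonneg
  have e5 := h1 h hhδ₁
  linarith

end Chernoff

end LCSemigroup

theorem theorem6p3 {𝕜 : Type*} [RCLike 𝕜] {X : Type*} [AddCommGroup X] [Module 𝕜 X]
    [UniformSpace X] [IsUniformAddGroup X] [T2Space X]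
    {Ω : Type*} (p : SeminormFamily 𝕜 X Ω) (hp : WithSeminorms p)
    (hX : LCSemigroup.SeqComplete X)
    (A B Z : X →ₗ.[𝕜] X) (expA expB expZ : ℝ≥0 → X →L[𝕜] X)
    (hA : LCSemigroup.IsGeneratorOf p A expA)
    (hB : LCSemigroup.IsGeneratorOf p B expB)
    (hZ : LCSemigroup.IsGeneratorOf p Z expZ)
    (D : Set X) (hD : LCSemigroup.IsCore Z D)
    (hDA : D ⊆ A.domain) (hDB : D ⊆ B.domain)
    (hsum : ∀ (f : X) (hf : f ∈ D),
      Z ⟨f, hD.subset_domain hf⟩ = A ⟨f, hDA hf⟩ + B ⟨f, hDB hf⟩)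
    (hE : LCSemigroup.MemE p fun s : ℝ≥0 => (expA s).comp (expB s)) :
    ∀ (f : X) (t₀ : ℝ≥0), 0 < t₀ →
      TendstoUniformlyOn
        (fun (n : ℕ) (t : ℝ≥0) =>
          (((expA (t / (n : ℝ≥0))).comp (expB (t / (n : ℝ≥0)))) ^ n) f)
        (fun t : ℝ≥0 => expZ t f) atTop (Set.Icc 0 t₀) := by
  intro f t₀ _
  refine hZ.chernoff hp hX hE hD (fun d e hd hde P hP ε hε => ?_) f t₀
  have he : e = A ⟨d, hDA hd⟩ + B ⟨d, hDB hd⟩ := by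
    rw [← hsum d hd]
    exact LinearPMap.mem_graph_snd_inj' Z hde (Z.mem_graph ⟨d, hD.subset_domain hd⟩) rfl
  rw [he]
  exact hA.comp_expansion hp hB (A.mem_graph ⟨d, hDA hd⟩) (B.mem_graph ⟨d, hDB hd⟩) hP hε
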